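/- A \emph{numerical semigroup} is a submonoid $S$ of $(\mathbb N,+)$ with finite complement; it has a unique minimal generating set, whose elements are its \emph{minimal generators}. Let $S$ be a numerical semigroup, and let $(e_j)_{j\ge1}$ be its \emph{cyclotomic exponent sequence}, i.e. the unique sequence of integers such that $$(1-x)\sum_{s\in S}x^s=\prod_{j=1}^\infty(1-x^j)^{e_j}\quad\text{in } \mathbb Z[\![x]\!].$$ Write $a\le_S b$ if $b-a\in S$. For $s\in S$ let $\nabla_s$ be the graph whose vertices are the factorizations of $s$, i.e. the tuples of non-negative integers $(a_n)$ indexed by the minimal generators $n$ of $S$ with $\sum_n a_n n=s$, two distinct factorizations $x,y$ being adjacent when $x\cdot y\ne0$ (that is, when they have a minimal generator in common). The connected components of $\nabla_s$ are the \emph{$R$-classes} of $s$, and $\operatorname{Betti}(S)$ is the set of $s\in S$ for which $\nabla_s$ is not connected. Let $$\mathcal E(S)=\{d\in\mathbb N: d\ge2,\ e_d\ne0,\ d\text{ is not a minimal generator of }S\},$$ and for $X\subseteq\mathbb N$ let $\operatorname{U}(X)$ be the set of $x\in X$ such that $\{y\in X: y\le_S x\}$ is totally ordered by $\le_S$. Then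 $\operatorname{U}(\operatorname{Betti}(S))=\operatorname{U}(\mathcal E(S))$, and for every $b\in\operatorname{U}(\operatorname{Betti}(S))$ the exponent $e_b$ equals the number of $R$-classes of $b$ minus $1$. -/

import Mathlib

open PowerSeries
open scoped PowerSeries.WithPiTopology

namespace NumSgp

/-- A numerical semigroup: a submonoid of `(ℕ, +)` with finite complement. -/
def IsNumericalSemigroup (S : AddSubmonoid ℕ) : Prop :=
  ((S : Set ℕ)ᶜ).Finite

/-- The relation `a ≤_S b`, that is, `b - a ∈ S`. -/
def leS (S : AddSubmonoid ℕ) (a b : ℕ) : Prop :=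
  ∃ s ∈ S, a + s = b

/-- `U(X)` for a set `X` ordered by `r`: the elements of `X` whose down-set in `X` is totally
ordered. -/
def U {α : Type*} (r : α → α → Prop) (X : Set α) : Set α :=
  {x | x ∈ X ∧ IsChain r {y | y ∈ X ∧ r y x}}

/-! ### Minimal generators, factorizations and Betti elements -/

/-- The minimal generators of `S`: the nonzero elements that are not a sum of two nonzero
elements of `S`. By the two lemmas below this is the least generating set of `S`. -/
def minimalGenerators (S : AddSubmonoid ℕ) : Set ℕ :=
  {n | n ∈ S ∧ n ≠ 0 ∧ ∀ a ∈ S, ∀ b ∈ S, a + b = n → a = 0 ∨ b = 0}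

theorem closure_minimalGenerators (S : AddSubmonoid ℕ) :
    AddSubmonoid.closure (minimalGenerators S) = S := by
  apply le_antisymm
  · exact (AddSubmonoid.closure_le).2 fun n hn => hn.1
  · intro n
    induction n using Nat.strong_induction_on with
    | _ n ih =>
      intro hn
      by_cases h0 : n = 0
      · subst h0; exact zero_mem _
      by_cases hm : n ∈ minimalGenerators S
      · exact AddSubmonoid.subset_closure hm
      · have : ∃ a ∈ S, ∃ b ∈ S, a + b = n ∧ a ≠ 0 ∧ b ≠ 0 := by
          by_contra hcon
          apply hm
          refine ⟨hn, h0, fun a ha b hb hab => ?_⟩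
          by_contra h
          rw [not_or] at h
          exact hcon ⟨a, ha, b, hb, hab, h.1, h.2⟩
        obtain ⟨a, ha, b, hb, hab, ha0, hb0⟩ := this
        rw [← hab]
        exact add_mem (ih a (by omega) ha) (ih b (by omega) hb)

theorem minimalGenerators_subset (S : AddSubmonoid ℕ) (A : Set ℕ)
    (hA : AddSubmonoid.closure A = S) : minimalGenerators S ⊆ A := by
  intro n hn
  have key : ∀ m ∈ AddSubmonoid.closure A, m = 0 ∨ m ∈ A ∨
      ∃ a ∈ S, ∃ b ∈ S, a + b = m ∧ a ≠ 0 ∧ b ≠ 0 := by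
    intro m hm
    induction hm using AddSubmonoid.closure_induction with
    | mem x hx => exact Or.inr (Or.inl hx)
    | zero => exact Or.inl rfl
    | add x y hx hy _ _ =>
      by_cases hx0 : x = 0
      · simpa [hx0]
      by_cases hy0 : y = 0
      · simpa [hy0]
      exact Or.inr (Or.inr ⟨x, hA ▸ hx, y, hA ▸ hy, rfl, hx0, hy0⟩)
  rcases key n (hA.symm ▸ hn.1) with h | h | ⟨a, ha, b, hb, hab, ha0, hb0⟩
  · exact absurd h hn.2.1
  · exact h
  · rcases hn.2.2 a ha b hb hab with h | h
    · exact absurd h ha0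
    · exact absurd h hb0

/-- The map `φ` sending a vector of multiplicities (indexed by the minimal generators) to the
corresponding element `∑ a_n n` of `S`. -/
def phi (S : AddSubmonoid ℕ) (z : minimalGenerators S →₀ ℕ) : ℕ :=
  z.sum fun n a => a * (n : ℕ)

/-- The set `Z(s)` of factorizations of `s`, as a type. -/
def Factorization (S : AddSubmonoid ℕ) (s : ℕ) : Type :=
  {z : minimalGenerators S →₀ ℕ // phi S z = s}

/-- The graph `∇_s` on `Z(s)`: distinct factorizations are joined if they have a minimal generator
in common. -/
def nabla (S : AddSubmonoid ℕ) (s : ℕ) : SimpleGraph (Factorization S s) where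
  Adj x y := x ≠ y ∧ ∃ n, x.1 n ≠ 0 ∧ y.1 n ≠ 0
  symm := ⟨fun _ _ h => ⟨h.1.symm, h.2.imp fun _ hn => ⟨hn.2, hn.1⟩⟩⟩
  loopless := ⟨fun _ h => h.1 rfl⟩

/-- The `R`-classes of `s`: the connected components of `∇_s`. -/
abbrev RClass (S : AddSubmonoid ℕ) (s : ℕ) : Type :=
  (nabla S s).ConnectedComponent

/-- The Betti elements of `S`: the `s ∈ S` such that `∇_s` is not connected. -/
def Betti (S : AddSubmonoid ℕ) : Set ℕ :=
  {s | s ∈ S ∧ ¬ (nabla S s).Connected}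

/-! ### The cyclotomic exponent sequence -/

open Classical in
/-- The Hilbert series `H_S(x) = ∑_{s ∈ S} x^s`. -/
noncomputable def hilbertSeries (S : AddSubmonoid ℕ) : ℤ⟦X⟧ :=
  PowerSeries.mk fun n => if n ∈ S then 1 else 0

/-- The semigroup polynomial `P_S(x) = (1 - x) H_S(x)`, as a formal power series. -/
noncomputable def semigroupPolynomial (S : AddSubmonoid ℕ) : ℤ⟦X⟧ :=
  (1 - X) * hilbertSeries S

theorem oneSubXPow_aux (j : ℕ+) :
    ((1 : ℤ⟦X⟧) - X ^ (j : ℕ)) * PowerSeries.mk (fun n => if (j : ℕ) ∣ n then 1 else 0) = 1 := by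
  ext n
  rw [sub_mul, one_mul, map_sub, coeff_X_pow_mul', coeff_mk, coeff_one]
  have hj := j.pos
  by_cases hn : (j : ℕ) ≤ n
  · have h0 : n ≠ 0 := by omega
    have hd : (j : ℕ) ∣ n - j ↔ (j : ℕ) ∣ n :=
      ⟨fun h => (Nat.sub_add_cancel hn) ▸ Nat.dvd_add h dvd_rfl, fun h => Nat.dvd_sub h dvd_rfl⟩
    simp [hn, h0, hd]
  · by_cases h0 : n = 0
    · simp [h0]
    · have : ¬ (j : ℕ) ∣ n := fun h => hn (Nat.le_of_dvd (Nat.pos_of_ne_zero h0) h)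
      simp [hn, h0, this]

/-- `1 - x^j` as a unit of `ℤ⟦x⟧`, with inverse `1 + x^j + x^(2j) + ⋯`. -/
noncomputable def oneSubXPow (j : ℕ+) : ℤ⟦X⟧ˣ where
  val := 1 - X ^ (j : ℕ)
  inv := PowerSeries.mk fun n => if (j : ℕ) ∣ n then 1 else 0
  val_inv := oneSubXPow_aux j
  inv_val := by rw [mul_comm]; exact oneSubXPow_aux j

/-- `e_1, e_2, …` is the cyclotomic exponent sequence of `S`: `P_S(x) = ∏_{j ≥ 1} (1 - x^j)^{e_j}`
in `ℤ⟦x⟧` (with coefficientwise convergence; `ℤ` is discrete). The value `e 0` plays no role.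
The lemma `existsUnique_isCyclotomicExponentSequence` below shows that such a sequence exists and
is unique. -/
def IsCyclotomicExponentSequence (S : AddSubmonoid ℕ) (e : ℕ → ℤ) : Prop :=
  HasProd (fun j : ℕ+ => ((oneSubXPow j ^ e j : ℤ⟦X⟧ˣ) : ℤ⟦X⟧)) (semigroupPolynomial S)

/-- The set `𝓔(S)` of those `d ≥ 2` with `e_d ≠ 0` that are not minimal generators of `S`. -/
def exponentSet (S : AddSubmonoid ℕ) (e : ℕ → ℤ) : Set ℕ :=
  {d | 2 ≤ d ∧ e d ≠ 0 ∧ d ∉ minimalGenerators S}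

/-! ### Existence and uniqueness of the cyclotomic exponent sequence -/

theorem X_pow_dvd_mul {k : ℕ} (hk : 1 ≤ k) {u v : ℤ⟦X⟧} {a b : ℤ}
    (hu : X ^ (k + 1) ∣ u - (1 - C a * X ^ k)) (hv : X ^ (k + 1) ∣ v - (1 - C b * X ^ k)) :
    X ^ (k + 1) ∣ u * v - (1 - C (a + b) * X ^ k) := by
  have h2 : (X : ℤ⟦X⟧) ^ (k + 1) ∣ C a * C b * (X ^ k * X ^ k) := by
    rw [← pow_add]
    exact Dvd.dvd.mul_left (pow_dvd_pow _ (by omega)) _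
  have : u * v - (1 - C (a + b) * X ^ k) = (u - (1 - C a * X ^ k)) * v +
      (1 - C a * X ^ k) * (v - (1 - C b * X ^ k)) + C a * C b * (X ^ k * X ^ k) := by
    rw [map_add]; ring
  rw [this]
  exact dvd_add (dvd_add (Dvd.dvd.mul_right hu _) (Dvd.dvd.mul_left hv _)) h2

theorem X_pow_dvd_inv {k : ℕ} (hk : 1 ≤ k) {u : ℤ⟦X⟧ˣ} {a : ℤ}
    (hu : X ^ (k + 1) ∣ (u : ℤ⟦X⟧) - (1 - C a * X ^ k)) :
    X ^ (k + 1) ∣ ((u⁻¹ : ℤ⟦X⟧ˣ) : ℤ⟦X⟧) - (1 - C (-a) * X ^ k) := by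
  have h := X_pow_dvd_mul (v := 1 - C (-a) * X ^ k) (b := -a) hk hu (by simp)
  have : ((u⁻¹ : ℤ⟦X⟧ˣ) : ℤ⟦X⟧) - (1 - C (-a) * X ^ k) =
      -(((u⁻¹ : ℤ⟦X⟧ˣ) : ℤ⟦X⟧) * ((u : ℤ⟦X⟧) * (1 - C (-a) * X ^ k) - (1 - C (a + -a) * X ^ k))) := by
    rw [mul_sub, ← mul_assoc, Units.inv_mul]
    simp
  rw [this]
  exact (Dvd.dvd.mul_left h _).neg_right

theorem X_pow_dvd_zpow (j : ℕ+) (e : ℤ) :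
    X ^ ((j : ℕ) + 1) ∣ ((oneSubXPow j ^ e : ℤ⟦X⟧ˣ) : ℤ⟦X⟧) - (1 - C e * X ^ (j : ℕ)) := by
  have hu : X ^ ((j : ℕ) + 1) ∣ ((oneSubXPow j : ℤ⟦X⟧ˣ) : ℤ⟦X⟧) - (1 - C 1 * X ^ (j : ℕ)) := by
    simp [oneSubXPow]
  induction e using Int.induction_on with
  | zero => simp
  | succ i ih =>
    rw [zpow_add_one, Units.val_mul]
    exact X_pow_dvd_mul j.pos ih hu
  | pred i ih =>
    rw [zpow_sub_one, Units.val_mul]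
    exact X_pow_dvd_mul j.pos ih (X_pow_dvd_inv j.pos hu)

theorem coeff_mul_zpow (F : ℤ⟦X⟧) (j : ℕ+) (e : ℤ) (n : ℕ) (hn : n ≤ j) :
    coeff n (F * ((oneSubXPow j ^ e : ℤ⟦X⟧ˣ) : ℤ⟦X⟧)) =
      coeff n F - if n = j then e * constantCoeff F else 0 := by
  obtain ⟨g, hg⟩ := X_pow_dvd_zpow j e
  rw [sub_eq_iff_eq_add] at hg
  have : F * ((oneSubXPow j ^ e : ℤ⟦X⟧ˣ) : ℤ⟦X⟧) =
      F - C e * (X ^ (j : ℕ) * F) + X ^ ((j : ℕ) + 1) * (F * g) := by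
    rw [hg]; ring
  rw [this, map_add, map_sub, coeff_C_mul, coeff_X_pow_mul', coeff_X_pow_mul']
  rcases hn.eq_or_lt with h | h
  · simp [h]
  · simp [h.ne, h.not_ge, show ¬ (j : ℕ) + 1 ≤ n by omega]

/-- The partial products `∏_{1 ≤ j ≤ N} (1 - x^j)^{e_j}`. -/
noncomputable def partialProd (e : ℕ → ℤ) (N : ℕ) : ℤ⟦X⟧ :=
  ∏ i ∈ Finset.range N, ((oneSubXPow i.succPNat ^ e (i + 1) : ℤ⟦X⟧ˣ) : ℤ⟦X⟧)

theorem constantCoeff_partialProd (e : ℕ → ℤ) (N : ℕ) : constantCoeff (partialProd e N) = 1 := by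
  induction N with
  | zero => simp [partialProd]
  | succ N ih =>
    have h := coeff_mul_zpow (partialProd e N) N.succPNat (e (N + 1)) 0 (Nat.zero_le _)
    rw [partialProd, Finset.prod_range_succ, ← partialProd]
    simpa [ih] using h

theorem coeff_partialProd_succ (e : ℕ → ℤ) (N n : ℕ) (hn : n ≤ N + 1) :
    coeff n (partialProd e (N + 1)) =
      coeff n (partialProd e N) - if n = N + 1 then e (N + 1) else 0 := by
  have h := coeff_mul_zpow (partialProd e N) N.succPNat (e (N + 1)) n (by simpa using hn)
  rw [partialProd, Finset.prod_range_succ, ← partialProd]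
  simpa [constantCoeff_partialProd] using h

theorem coeff_partialProd_of_le (e : ℕ → ℤ) (n N : ℕ) (hN : n ≤ N) :
    coeff n (partialProd e N) = coeff n (partialProd e n) := by
  induction N, hN using Nat.le_induction with
  | base => rfl
  | succ N hN ih =>
    rw [coeff_partialProd_succ e N n (by omega), ih]
    simp [show n ≠ N + 1 by omega]

theorem tendsto_partialProd_iff (e : ℕ → ℤ) (f : ℤ⟦X⟧) :
    Filter.Tendsto (partialProd e) Filter.atTop (nhds f) ↔
      ∀ n, coeff n (partialProd e n) = coeff n f := by
  rw [WithPiTopology.tendsto_iff_coeff_tendsto]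
  refine forall_congr' fun n => ?_
  have hc : Filter.Tendsto (fun N => coeff n (partialProd e N)) Filter.atTop
      (nhds (coeff n (partialProd e n))) := by
    apply tendsto_const_nhds.congr'
    filter_upwards [Filter.eventually_ge_atTop n] with N hN
    exact (coeff_partialProd_of_le e n N hN).symm
  exact ⟨fun h => tendsto_nhds_unique hc h, fun h => h ▸ hc⟩

theorem hasProd_iff_coeff (e : ℕ → ℤ) (f : ℤ⟦X⟧) :
    HasProd (fun j : ℕ+ => ((oneSubXPow j ^ e j : ℤ⟦X⟧ˣ) : ℤ⟦X⟧)) f ↔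
      ∀ n, coeff n (partialProd e n) = coeff n f := by
  rw [← tendsto_partialProd_iff, ← Equiv.pnatEquivNat.symm.hasProd_iff]
  have hm : Multipliable ((fun j : ℕ+ => ((oneSubXPow j ^ e j : ℤ⟦X⟧ˣ) : ℤ⟦X⟧)) ∘
      Equiv.pnatEquivNat.symm) := by
    have := WithPiTopology.multipliable_one_add_of_tendsto_order_atTop_nhds_top (R := ℤ)
      (f := fun i : ℕ => ((oneSubXPow i.succPNat ^ e (i + 1) : ℤ⟦X⟧ˣ) : ℤ⟦X⟧) - 1) (by
        rw [ENat.tendsto_nhds_top_iff_natCast_lt]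
        intro n
        filter_upwards [Filter.eventually_ge_atTop n] with i hi
        refine lt_of_lt_of_le (b := ((i + 1 : ℕ) : ℕ∞)) (by exact_mod_cast (by omega)) ?_
        refine nat_le_order _ _ fun m hm => ?_
        have h := coeff_mul_zpow 1 i.succPNat (e (i + 1)) m (by simp; omega)
        simp only [one_mul] at h
        rw [map_sub, h]
        simp [hm.ne])
    simpa [Function.comp_def] using this
  constructor
  · intro h
    exact h.tendsto_prod_nat
  · intro h
    have h2 := hm.hasProd
    have h3 := h2.tendsto_prod_nat
    rwa [tendsto_nhds_unique h h3]

theorem existsUnique_isCyclotomicExponentSequence (S : AddSubmonoid ℕ) :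
    ∃ e : ℕ → ℤ, IsCyclotomicExponentSequence S e ∧
      ∀ e' : ℕ → ℤ, IsCyclotomicExponentSequence S e' → ∀ j, 1 ≤ j → e' j = e j := by
  have hP : coeff 0 (semigroupPolynomial S) = 1 := by
    simp [semigroupPolynomial, hilbertSeries]
  have hex : ∀ N, ∃ e : ℕ → ℤ, ∀ n ≤ N,
      coeff n (partialProd e n) = coeff n (semigroupPolynomial S) := by
    intro N
    induction N with
    | zero =>
      refine ⟨0, fun n hn => ?_⟩
      obtain rfl : n = 0 := by omega
      rw [hP]; simp [partialProd]
    | succ N ih =>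
      obtain ⟨e, he⟩ := ih
      let c := coeff (N + 1) (partialProd e N) - coeff (N + 1) (semigroupPolynomial S)
      have hcongr : ∀ n ≤ N, partialProd (Function.update e (N + 1) c) n = partialProd e n := by
        intro n hn
        refine Finset.prod_congr rfl fun i hi => ?_
        rw [Finset.mem_range] at hi
        rw [Function.update_of_ne (by omega)]
      refine ⟨Function.update e (N + 1) c, fun n hn => ?_⟩
      rcases hn.eq_or_lt with rfl | h
      · rw [coeff_partialProd_succ _ _ _ le_rfl, hcongr N le_rfl]
        simp [c]
      · rw [hcongr n (by omega), he n (by omega)]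
  have huniq : ∀ (e e' : ℕ → ℤ) (N : ℕ),
      (∀ n ≤ N, coeff n (partialProd e n) = coeff n (semigroupPolynomial S)) →
      (∀ n ≤ N, coeff n (partialProd e' n) = coeff n (semigroupPolynomial S)) →
      ∀ j, 1 ≤ j → j ≤ N → e' j = e j := by
    intro e e' N h h' j
    induction j using Nat.strong_induction_on with
    | _ j ih =>
      intro hj hjN
      obtain ⟨k, rfl⟩ : ∃ k, j = k + 1 := ⟨j - 1, by omega⟩
      have hcongr : partialProd e' k = partialProd e k := by
        refine Finset.prod_congr rfl fun i hi => ?_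
        rw [Finset.mem_range] at hi
        rw [ih (i + 1) (by omega) (by omega) (by omega)]
      have h1 := h (k + 1) hjN
      have h2 := h' (k + 1) hjN
      rw [coeff_partialProd_succ _ _ _ le_rfl] at h1 h2
      rw [hcongr] at h2
      simp only [if_true] at h1 h2
      omega
  choose E hE using hex
  have hdiag : ∀ n, coeff n (partialProd (fun j => E j j) n) =
      coeff n (semigroupPolynomial S) := by
    intro n
    rw [← hE n n le_rfl]
    congr 1
    refine Finset.prod_congr rfl fun i hi => ?_
    rw [Finset.mem_range] at hi
    have hh := huniq (E n) (E (i + 1)) (i + 1) (fun m hm => hE n m (by omega)) (hE (i + 1)) (i + 1)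
      (by omega) le_rfl
    simp only [hh]
  generalize (fun j => E j j) = e at hdiag
  refine ⟨e, (hasProd_iff_coeff e _).2 hdiag, fun e' he' j hj => ?_⟩
  have h' := (hasProd_iff_coeff e' _).1 he'
  exact huniq e e' j (fun n _ => hdiag n) (fun n _ => h' n) j hj le_rfl

end NumSgp

/-! Fix `t` such that the Betti elements `b ≤_S t` form a chain. Then each such `b` has at most one
`R`-class that is not a singleton (`linked_of_not_isolated`). Choose a factorization `rep S b`, in
that class if it exists, and call the factorizations of `b` outside its class marked. Marked
factorizations below `t` have pairwise disjoint supports (`Marked.not_meets`).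

Rewrite each marked `z` to `rep S (phi S z)`. Disjoint supports make this confluent
(`Step.diamond`), and a weight makes it terminate (`weight_rep_lt`), so every element of `S` below
`t` has exactly one factorization containing no marked one. Disjointness also makes the generating
function of such factorizations a product, namely `∏_z (1 - x^φ(z)) / ∏_g (1 - x^g)`, over the
marked `z` below `t` and the minimal generators `g`. It therefore agrees with `H_S` at every `u ≤_S
t`.

All series involved are supported on `S`, so the exponent at `t` depends only on coefficients and
exponents at elements below `t` (`exponent_eq_of_agreeBelow`). Hence, for `t ≥ 2` not a minimal
generator, `e_t` is the number of marked factorizations of `t`, that is, the number of `R`-classes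
minus 1 if `t ∈ S`. Being a Betti element and lying in `𝓔(S)` are thus equivalent at such `t`. For
an element of `U(𝓔(S))` the chain hypothesis on Betti elements is recovered by induction
(`bettiChain_of_mem_U`). -/

namespace NumSgp

/-! ### Factorizations and `R`-classes -/

section Factorizations

variable {S : AddSubmonoid ℕ}

theorem phi_add (x y : minimalGenerators S →₀ ℕ) : phi S (x + y) = phi S x + phi S y :=
  Finsupp.sum_add_index' (by simp) (by intros; ring)

@[simp]
theorem phi_zero : phi S 0 = 0 := Finsupp.sum_zero_index

theorem phi_single (g : minimalGenerators S) (k : ℕ) : phi S (Finsupp.single g k) = k * g :=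
  Finsupp.sum_single_index (by simp)

theorem phi_mem (x : minimalGenerators S →₀ ℕ) : phi S x ∈ S :=
  sum_mem fun g _ => by
    simpa using nsmul_mem g.2.1 (x g)

theorem le_phi (x : minimalGenerators S →₀ ℕ) (g : minimalGenerators S) : x g ≤ phi S x := by
  by_cases hg : x g = 0
  · simp [hg]
  · calc x g ≤ x g * g := Nat.le_mul_of_pos_right _ (Nat.pos_of_ne_zero g.2.2.1)
      _ ≤ phi S x := Finset.single_le_sum (f := fun n : minimalGenerators S => x n * (n : ℕ))
        (fun _ _ => Nat.zero_le _) (Finsupp.mem_support_iff.2 hg)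

theorem phi_eq_zero {x : minimalGenerators S →₀ ℕ} : phi S x = 0 ↔ x = 0 := by
  refine ⟨fun h => ?_, fun h => h ▸ phi_zero⟩
  ext g
  have := le_phi x g
  simp only [Finsupp.coe_zero, Pi.zero_apply]
  omega

theorem exists_phi_eq {s : ℕ} (hs : s ∈ S) : ∃ x, phi S x = s := by
  rw [← closure_minimalGenerators S] at hs
  induction hs using AddSubmonoid.closure_induction with
  | mem g hg => exact ⟨Finsupp.single ⟨g, hg⟩ 1, by simp [phi_single]⟩
  | zero => exact ⟨0, phi_zero⟩
  | add a b _ _ ha hb =>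
    obtain ⟨x, rfl⟩ := ha
    obtain ⟨y, rfl⟩ := hb
    exact ⟨x + y, phi_add x y⟩

theorem finite_factorizations [Finite (minimalGenerators S)] (s : ℕ) :
    {x | phi S x = s}.Finite := by
  refine (Set.finite_Icc 0 (Finsupp.equivFunOnFinite.symm fun _ => s)).subset fun x hx => ?_
  refine ⟨zero_le, fun g => ?_⟩
  simpa [← (show phi S x = s from hx)] using le_phi x g

theorem finite_minimalGenerators (hS : IsNumericalSemigroup S) :
    (minimalGenerators S).Finite := by
  obtain ⟨m, hm⟩ := hS.bddAbove
  have hmem : ∀ n, m < n → n ∈ S := fun n hn => by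
    by_contra h
    exact absurd (hm h) (by omega)
  -- Beyond `2m + 2`, both `m + 1` and `n - (m + 1)` exceed every gap, so `n` splits.
  refine (Set.finite_Iic (2 * m + 2)).subset fun n hn => ?_
  by_contra h
  rw [Set.mem_Iic] at h
  have := hn.2.2 (m + 1) (hmem _ (by omega)) (n - (m + 1)) (hmem _ (by omega)) (by omega)
  omega

theorem leS.refl (a : ℕ) : leS S a a := ⟨0, zero_mem _, rfl⟩

theorem leS.trans {a b c : ℕ} (h : leS S a b) (h' : leS S b c) : leS S a c := by
  obtain ⟨s, hs, rfl⟩ := h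
  obtain ⟨s', hs', rfl⟩ := h'
  exact ⟨s + s', add_mem hs hs', by ring⟩

theorem leS.le {a b : ℕ} (h : leS S a b) : a ≤ b := by
  obtain ⟨s, -, rfl⟩ := h
  omega

/-- Two factorizations meet if they have a minimal generator in common. -/
def Meets (x y : minimalGenerators S →₀ ℕ) : Prop := ∃ n, x n ≠ 0 ∧ y n ≠ 0

theorem Meets.symm {x y : minimalGenerators S →₀ ℕ} (h : Meets x y) : Meets y x :=
  h.imp fun _ h => h.symm

theorem meets_add_left {x x' : minimalGenerators S →₀ ℕ} (hx : x ≠ 0) (y y') (hxx : x = x') :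
    Meets (x + y) (x' + y') := by
  subst hxx
  obtain ⟨g, hg⟩ := DFunLike.ne_iff.1 hx
  simp only [Finsupp.coe_zero, Pi.zero_apply] at hg
  exact ⟨g, by simp [hg], by simp [hg]⟩

theorem Meets.add_left {x y : minimalGenerators S →₀ ℕ} (h : Meets x y) (z) :
    Meets (x + z) y := by
  obtain ⟨g, h1, h2⟩ := h
  exact ⟨g, by simp [h1], h2⟩

theorem exists_eq_single_add {x : minimalGenerators S →₀ ℕ} {g : minimalGenerators S}
    (h : x g ≠ 0) : ∃ y, x = Finsupp.single g 1 + y := by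
  refine exists_add_of_le (Finsupp.single_le_iff.2 ?_)
  omega

/-- Two factorizations of the same element lie in the same `R`-class. -/
def Linked (x y : minimalGenerators S →₀ ℕ) : Prop :=
  Relation.ReflTransGen (fun x y => phi S x = phi S y ∧ Meets x y) x y

theorem Linked.symm {x y : minimalGenerators S →₀ ℕ} (h : Linked x y) : Linked y x :=
  have : Std.Symm fun x y : minimalGenerators S →₀ ℕ => phi S x = phi S y ∧ Meets x y :=
    ⟨fun _ _ h => ⟨h.1.symm, h.2.symm⟩⟩
  Relation.ReflTransGen.stdSymm.symm _ _ h

theorem Meets.linked {x y : minimalGenerators S →₀ ℕ} (h : Meets x y) (hp : phi S x = phi S y) :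
    Linked x y :=
  Relation.ReflTransGen.single ⟨hp, h⟩

theorem reachable_iff_linked {s : ℕ} (a b : Factorization S s) :
    (nabla S s).Reachable a b ↔ Linked a.1 b.1 := by
  constructor
  · intro h
    rw [SimpleGraph.reachable_iff_reflTransGen] at h
    exact h.lift Subtype.val fun x y hxy => ⟨x.2.trans y.2.symm, hxy.2⟩
  · intro h
    obtain ⟨x, hx⟩ := a
    obtain ⟨y, hy⟩ := b
    change Linked x y at h
    induction h with
    | refl => rfl
    | @tail u v _ h ih =>
      have hu := h.1.trans hy
      refine (ih hu).trans ?_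
      by_cases huv : u = v
      · subst huv; rfl
      · exact SimpleGraph.Adj.reachable ⟨fun h => huv (congrArg Subtype.val h), h.2⟩

theorem mem_Betti_iff {s : ℕ} :
    s ∈ Betti S ↔ ∃ x y, phi S x = s ∧ phi S y = s ∧ ¬ Linked x y := by
  constructor
  · rintro ⟨hs, h⟩
    by_contra! hcon
    obtain ⟨x, hx⟩ := exists_phi_eq hs
    have : Nonempty (Factorization S s) := ⟨⟨x, hx⟩⟩
    exact h ⟨fun a b => (reachable_iff_linked a b).2 (hcon _ _ a.2 b.2)⟩
  · rintro ⟨x, y, hx, hy, h⟩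
    exact ⟨hx ▸ phi_mem x,
      fun hc => h ((reachable_iff_linked ⟨x, hx⟩ ⟨y, hy⟩).1 (hc.preconnected _ _))⟩

/-- A factorization is isolated if it is the only element of its `R`-class. -/
def Isolated (x : minimalGenerators S →₀ ℕ) : Prop :=
  ∀ y, phi S x = phi S y → Meets x y → y = x

theorem Isolated.eq_of_linked {x y : minimalGenerators S →₀ ℕ} (hx : Isolated x)
    (h : Linked x y) : y = x := by
  induction h with
  | refl => rfl
  | tail _ h ih =>
    subst ih
    exact hx _ h.1 h.2

/-- If two distinct factorizations of `s` share a generator, cancel it and descend. Otherwise all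
`R`-classes of `s` are singletons, and `s` itself is a Betti element. -/
theorem exists_Betti_le {x y : minimalGenerators S →₀ ℕ} (hxy : x ≠ y) (h : phi S x = phi S y) :
    ∃ b ∈ Betti S, leS S b (phi S x) := by
  induction hs : phi S x using Nat.strong_induction_on generalizing x y with
  | _ s ih =>
    by_cases hm : ∃ u v : minimalGenerators S →₀ ℕ, u ≠ v ∧ phi S u = s ∧ phi S v = s ∧ Meets u v
    · obtain ⟨u, v, huv, hu, hv, g, hug, hvg⟩ := hm
      obtain ⟨u, rfl⟩ := exists_eq_single_add hug
      obtain ⟨v, rfl⟩ := exists_eq_single_add hvg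
      rw [phi_add, phi_single, one_mul] at hu hv
      have := Nat.pos_of_ne_zero g.2.2.1
      obtain ⟨b, hb, hbs⟩ := ih (phi S u) (by omega) (x := u) (y := v)
        (fun h => huv (by rw [h])) (by omega) rfl
      exact ⟨b, hb, hbs.trans ⟨g, g.2.1, by omega⟩⟩
    · refine ⟨s, mem_Betti_iff.2 ⟨x, y, hs, h ▸ hs, fun hl => hxy ?_⟩, leS.refl s⟩
      refine (Isolated.eq_of_linked (fun z hz hxz => ?_) hl).symm
      by_contra hne
      exact hm ⟨x, z, Ne.symm hne, hs, hz ▸ hs, hxz⟩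

/-- The Betti elements below `t` are totally ordered. -/
def BettiChain (S : AddSubmonoid ℕ) (t : ℕ) : Prop :=
  IsChain (leS S) {b | b ∈ Betti S ∧ leS S b t}

theorem BettiChain.mono {s t : ℕ} (ht : BettiChain S t) (h : leS S s t) : BettiChain S s :=
  IsChain.mono (fun _ hb => And.intro hb.1 (leS.trans hb.2 h)) ht

theorem BettiChain.total {t b b' : ℕ} (ht : BettiChain S t) (hb : b ∈ Betti S) (hbt : leS S b t)
    (hb' : b' ∈ Betti S) (hbt' : leS S b' t) : leS S b b' ∨ leS S b' b := by
  by_cases h : b = b'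
  · exact Or.inl (h ▸ leS.refl b)
  · exact ht ⟨hb, hbt⟩ ⟨hb', hbt'⟩ h

theorem Betti.pos {b : ℕ} (hb : b ∈ Betti S) : b ≠ 0 := by
  rintro rfl
  obtain ⟨x, y, hx, hy, h⟩ := mem_Betti_iff.1 hb
  rw [phi_eq_zero] at hx hy
  exact h (hx ▸ hy ▸ Relation.ReflTransGen.refl)

/-- The `R`-class of a nonisolated factorization contains a proper multiple of any sufficiently
small Betti element. -/
theorem exists_linked_of_not_isolated {x : minimalGenerators S →₀ ℕ} (hx : ¬ Isolated x) :
    ∃ b ∈ Betti S, leS S b (phi S x) ∧ ∃ w ≠ 0, b + phi S w = phi S x ∧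
      ∀ z, phi S z = b → Linked x (w + z) := by
  simp only [Isolated, not_forall] at hx
  obtain ⟨y, hxy, ⟨g, hgx, hgy⟩, hne⟩ := hx
  obtain ⟨x, rfl⟩ := exists_eq_single_add hgx
  obtain ⟨y, rfl⟩ := exists_eq_single_add hgy
  rw [phi_add, phi_add] at hxy
  -- The common generator `g` is cancelled before a Betti element is sought, so `g` stays in the
  -- complement of `b` and links the new factorizations to the original one.
  obtain ⟨b, hb, hbx⟩ := exists_Betti_le (x := x) (y := y) (fun h => hne (by rw [h])) (by omega)
  obtain ⟨c, hc, hbc⟩ := hbx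
  obtain ⟨w, rfl⟩ := exists_phi_eq hc
  have hg : Finsupp.single g 1 ≠ 0 := by simp
  refine ⟨b, hb, ⟨phi S (Finsupp.single g 1 + w), phi_mem _, ?_⟩, Finsupp.single g 1 + w,
    fun h => hg ?_, ?_, fun z hz => ?_⟩
  · rw [phi_add, phi_add]; omega
  · exact (add_eq_zero.1 h).1
  · rw [phi_add, phi_add]; omega
  · rw [add_assoc]
    refine (meets_add_left hg _ _ rfl).linked ?_
    simp only [phi_add]; omega

/-- Each class contains all the vectors `w + z` with `z` any factorization of some smaller Betti
element. Two such Betti elements are comparable, so a factorization of the larger can be chosen to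
extend one of the smaller, and the two classes then have members that meet. -/
theorem linked_of_not_isolated {x x' : minimalGenerators S →₀ ℕ} (ht : BettiChain S (phi S x))
    (hxx : phi S x = phi S x') (hx : ¬ Isolated x) (hx' : ¬ Isolated x') : Linked x x' := by
  obtain ⟨b, hb, hbx, w, hw, hbw, h⟩ := exists_linked_of_not_isolated hx
  obtain ⟨b', hb', hbx', w', hw', hbw', h'⟩ := exists_linked_of_not_isolated hx'
  have key : ∀ {x x' w w' : minimalGenerators S →₀ ℕ} {b b' : ℕ}, phi S x = phi S x' → b ∈ Betti S →
      b + phi S w = phi S x → b' + phi S w' = phi S x' → leS S b b' →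
      (∀ z, phi S z = b → Linked x (w + z)) →
      (∀ z, phi S z = b' → Linked x' (w' + z)) → Linked x x' := by
    intro x x' w w' b b' hxx hb hbw hbw' hle h h'
    obtain ⟨c, hc, rfl⟩ := hle
    obtain ⟨v, rfl⟩ := exists_phi_eq hc
    obtain ⟨z, rfl⟩ := exists_phi_eq hb.1
    have hz : z ≠ 0 := fun h0 => Betti.pos hb (phi_eq_zero.2 h0)
    refine (h z rfl).trans (Relation.ReflTransGen.trans ?_ (h' (z + v) (phi_add _ _)).symm)
    rw [add_comm w, add_comm w', add_assoc]
    refine (meets_add_left hz _ _ rfl).linked ?_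
    simp only [phi_add]; omega
  rcases ht.total hb hbx hb' (hxx ▸ hbx') with hle | hle
  · exact key hxx hb hbw hbw' hle h h'
  · exact (key hxx.symm hb' hbw' hbw hle h' h).symm

/-- An isolated factorization does not meet the factorizations of smaller Betti elements. -/
theorem Isolated.not_meets {x y : minimalGenerators S →₀ ℕ} (hx : Isolated x)
    (hy : phi S y ∈ Betti S) (hyx : leS S (phi S y) (phi S x)) (hne : phi S y ≠ phi S x) :
    ¬ Meets x y := by
  intro hm
  obtain ⟨c, hc, hyc⟩ := hyx
  obtain ⟨w, rfl⟩ := exists_phi_eq hc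
  have hw : w ≠ 0 := by rintro rfl; simp at hyc; omega
  have hyx := hx (y + w) (by rw [phi_add]; omega) (hm.symm.add_left w).symm
  subst hyx
  obtain ⟨u, v, hu, hv, huv⟩ := mem_Betti_iff.1 hy
  -- Now `x = y + w` is isolated, and replacing `y` by any `u` of the same value keeps the nonzero
  -- part `w` in common. So `y` would be the only factorization of a Betti element.
  have key : ∀ u, phi S u = phi S y → u = y := by
    intro u hu
    have h := hx (u + w) (by rw [phi_add, phi_add, hu]) (by
      rw [add_comm y, add_comm u]; exact meets_add_left hw _ _ rfl)
    exact add_right_cancel h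
  rw [key u hu, key v hv] at huv
  exact huv Relation.ReflTransGen.refl

open Classical in
/-- A factorization of `s`, which is not isolated if possible. -/
noncomputable def rep (S : AddSubmonoid ℕ) (s : ℕ) : minimalGenerators S →₀ ℕ :=
  if h : ∃ x, phi S x = s ∧ ¬ Isolated x then h.choose
  else if h : ∃ x, phi S x = s then h.choose else 0

theorem phi_rep {s : ℕ} (hs : s ∈ S) : phi S (rep S s) = s := by
  unfold rep
  split_ifs with h h'
  · exact h.choose_spec.1
  · exact h'.choose_spec
  · exact absurd (exists_phi_eq hs) h'

theorem not_isolated_rep {x : minimalGenerators S →₀ ℕ} (hx : ¬ Isolated x) :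
    ¬ Isolated (rep S (phi S x)) := by
  have h : ∃ y, phi S y = phi S x ∧ ¬ Isolated y := ⟨x, rfl, hx⟩
  unfold rep
  rw [dif_pos h]
  exact h.choose_spec.2

/-- A factorization is marked if it does not lie in the `R`-class of the chosen one. -/
def Marked (z : minimalGenerators S →₀ ℕ) : Prop := ¬ Linked z (rep S (phi S z))

theorem Marked.mem_Betti {z : minimalGenerators S →₀ ℕ} (hz : Marked z) : phi S z ∈ Betti S :=
  mem_Betti_iff.2 ⟨z, _, rfl, phi_rep (phi_mem z), hz⟩

theorem Marked.ne_zero {z : minimalGenerators S →₀ ℕ} (hz : Marked z) : z ≠ 0 :=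
  fun h => Betti.pos hz.mem_Betti (phi_eq_zero.2 h)

theorem Marked.isolated {z : minimalGenerators S →₀ ℕ} (hz : Marked z)
    (ht : BettiChain S (phi S z)) : Isolated z := by
  by_contra h
  exact hz (linked_of_not_isolated ht (phi_rep (phi_mem z)).symm h (not_isolated_rep h))

/-- With equal values this is isolation. Otherwise the values are comparable Betti elements, and the
isolated factorization of the larger avoids all factorizations of the smaller. -/
theorem Marked.not_meets {t : ℕ} (ht : BettiChain S t) {z z' : minimalGenerators S →₀ ℕ}
    (hz : Marked z) (hzt : leS S (phi S z) t) (hz' : Marked z') (hzt' : leS S (phi S z') t)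
    (hne : z ≠ z') : ¬ Meets z z' := by
  by_cases h : phi S z = phi S z'
  · exact fun hm => hne (hz.isolated (ht.mono hzt) _ h hm).symm
  rcases ht.total hz.mem_Betti hzt hz'.mem_Betti hzt' with hle | hle
  · exact fun hm => (hz'.isolated (ht.mono hzt')).not_meets hz.mem_Betti hle h hm.symm
  · exact (hz.isolated (ht.mono hzt)).not_meets hz'.mem_Betti hle (Ne.symm h)

theorem Marked.not_meets_rep {t : ℕ} (ht : BettiChain S t) {z : minimalGenerators S →₀ ℕ}
    (hz : Marked z) (hzt : leS S (phi S z) t) {b : ℕ} (hb : b ∈ Betti S)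
    (hbz : leS S b (phi S z)) : ¬ Meets z (rep S b) := by
  intro hm
  by_cases h : b = phi S z
  · subst h
    exact hz (hm.linked (phi_rep hb.1).symm)
  · refine (hz.isolated (ht.mono hzt)).not_meets (y := rep S b) ?_ ?_ ?_ hm <;> rwa [phi_rep hb.1]

/-! ### Normal factorizations -/

/-- Replace a marked factorization `z` by the chosen factorization of the same element. -/
def Step (t : ℕ) (x y : minimalGenerators S →₀ ℕ) : Prop :=
  ∃ z w, Marked z ∧ leS S (phi S z) t ∧ x = z + w ∧ y = rep S (phi S z) + w

theorem Step.add_left {t : ℕ} {x y : minimalGenerators S →₀ ℕ} (h : Step t x y)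
    (u : minimalGenerators S →₀ ℕ) : Step t (u + x) (u + y) := by
  obtain ⟨z, w, hz, hzt, rfl, rfl⟩ := h
  exact ⟨z, u + w, hz, hzt, add_left_comm _ _ _, add_left_comm _ _ _⟩

theorem le_of_le_add_of_not_meets {x y w : minimalGenerators S →₀ ℕ} (h : ¬ Meets x y)
    (hle : x ≤ y + w) : x ≤ w := by
  intro g
  by_cases hg : x g = 0
  · simp [hg]
  · have h1 : y g = 0 := by
      by_contra h'
      exact h ⟨g, hg, h'⟩
    have := hle g
    simpa [h1] using this

/-- Distinct marked vectors contained in `x` have disjoint supports, so their sum is contained in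
`x` and the two replacements commute. -/
theorem Step.diamond {t : ℕ} (ht : BettiChain S t) {x y y' : minimalGenerators S →₀ ℕ}
    (h : Step t x y) (h' : Step t x y') :
    ∃ u, Relation.ReflGen (Step t) y u ∧ Relation.ReflTransGen (Step t) y' u := by
  obtain ⟨z, w, hz, hzt, rfl, rfl⟩ := h
  obtain ⟨z', w', hz', hzt', hx, rfl⟩ := h'
  by_cases hzz : z = z'
  · subst hzz
    obtain rfl := add_left_cancel hx
    exact ⟨_, .refl, .refl⟩
  · have hle : z' ≤ w := le_of_le_add_of_not_meets (Marked.not_meets ht hz' hzt' hz hzt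
      (Ne.symm hzz)) (hx ▸ le_self_add)
    obtain ⟨v, rfl⟩ := exists_add_of_le hle
    obtain rfl : z + v = w' := by
      rw [add_left_comm] at hx
      exact add_left_cancel hx
    refine ⟨rep S (phi S z) + rep S (phi S z') + v, .single ⟨z', rep S (phi S z) + v, hz', hzt',
      add_left_comm _ _ _, ?_⟩, .single ⟨z, rep S (phi S z') + v, hz, hzt,
      add_left_comm _ _ _, ?_⟩⟩
    · rw [add_assoc, add_left_comm]
    · rw [add_assoc]

theorem join_of_phi_eq {t : ℕ} (ht : BettiChain S t) {x y : minimalGenerators S →₀ ℕ}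
    (hxy : phi S x = phi S y) (hx : leS S (phi S x) t) :
    Relation.Join (Relation.ReflTransGen (Step t)) x y := by
  have heq : Equivalence (Relation.Join (Relation.ReflTransGen (Step (S := S) t))) :=
    Relation.equivalence_join_reflTransGen fun _ _ _ => Step.diamond ht
  induction hs : phi S x using Nat.strong_induction_on generalizing x y with
  | _ s ih =>
    -- Along a link a common generator cancels, and the induction hypothesis applies to the
    -- remainders. Passing between classes costs one step, from a marked vector to `rep S s`.
    have hlink : ∀ {u v : minimalGenerators S →₀ ℕ}, Linked u v → phi S u = s →
        Relation.Join (Relation.ReflTransGen (Step t)) u v ∧ phi S v = s := by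
      intro u v h hu
      induction h with
      | refl => exact ⟨heq.refl _, hu⟩
      | tail _ h ih' =>
        obtain ⟨hj, hp⟩ := ih'
        refine ⟨heq.trans hj ?_, h.1 ▸ hp⟩
        obtain ⟨h1, g, hga, hgb⟩ := h
        obtain ⟨a, rfl⟩ := exists_eq_single_add hga
        obtain ⟨b, rfl⟩ := exists_eq_single_add hgb
        rw [phi_add, phi_add] at h1
        rw [phi_add, phi_single, one_mul] at hp
        have := Nat.pos_of_ne_zero g.2.2.1
        obtain ⟨c, hac, hbc⟩ := ih (phi S a) (by omega) (x := a) (y := b) (by omega)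
          (leS.trans ⟨g, g.2.1, by omega⟩ hx) rfl
        exact ⟨Finsupp.single g 1 + c, hac.lift _ fun _ _ h => h.add_left _,
          hbc.lift _ fun _ _ h => h.add_left _⟩
    have hrep : ∀ u, phi S u = s →
        Relation.Join (Relation.ReflTransGen (Step t)) u (rep S s) := by
      intro u hu
      by_cases hm : Marked u
      · refine ⟨rep S s, .single ⟨u, 0, hm, ?_, (add_zero u).symm, ?_⟩, .refl⟩
        · rwa [hu, ← hs]
        · rw [hu, add_zero]
      · rw [Marked, not_not, hu] at hm
        exact (hlink hm hu).1
    exact heq.trans (hrep x hs) (heq.symm (hrep y (hxy ▸ hs)))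

/-- A factorization is normal if it contains no marked factorization. -/
def Normal (t : ℕ) (x : minimalGenerators S →₀ ℕ) : Prop :=
  ∀ z, Marked z → leS S (phi S z) t → ¬ z ≤ x

theorem Normal.eq {t : ℕ} (ht : BettiChain S t) {x y : minimalGenerators S →₀ ℕ}
    (hx : Normal t x) (hy : Normal t y) (hxy : phi S x = phi S y) (hxt : leS S (phi S x) t) :
    x = y := by
  have key : ∀ {x y : minimalGenerators S →₀ ℕ}, Normal t x →
      Relation.ReflTransGen (Step t) x y → x = y := by
    intro x y hx h
    rcases h.cases_head with h | ⟨c, ⟨z, w, hz, hzt, rfl, -⟩, -⟩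
    · exact h
    · exact absurd le_self_add (hx z hz hzt)
  obtain ⟨u, hu, hv⟩ := join_of_phi_eq ht hxy hxt
  rw [key hx hu, key hy hv]

open Classical in
/-- The Betti element below `t` with a marked factorization that contains `g`. -/
noncomputable def level (t : ℕ) (g : minimalGenerators S) : ℕ :=
  if h : ∃ z : minimalGenerators S →₀ ℕ, Marked z ∧ leS S (phi S z) t ∧ z g ≠ 0
  then phi S h.choose else 0

theorem level_eq {t : ℕ} (ht : BettiChain S t) {z : minimalGenerators S →₀ ℕ} (hz : Marked z)
    (hzt : leS S (phi S z) t) {g : minimalGenerators S} (hg : z g ≠ 0) : level t g = phi S z := by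
  have h : ∃ z : minimalGenerators S →₀ ℕ, Marked z ∧ leS S (phi S z) t ∧ z g ≠ 0 :=
    ⟨z, hz, hzt, hg⟩
  unfold level
  rw [dif_pos h]
  congr 1
  obtain ⟨h1, h2, h3⟩ := h.choose_spec
  by_contra hne
  exact Marked.not_meets ht h1 h2 hz hzt hne ⟨g, h3, hg⟩

/-- A weight that decreases under `Step`. -/
noncomputable def weight (t : ℕ) (x : minimalGenerators S →₀ ℕ) : ℕ :=
  x.sum fun g a => a * (t + 1) ^ level t g

theorem weight_add {t : ℕ} (x y : minimalGenerators S →₀ ℕ) :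
    weight t (x + y) = weight t x + weight t y :=
  Finsupp.sum_add_index' (by simp) (by intros; ring)

/-- Let `b = phi S z`. Every generator in `z` has level `b`, while those in `rep S b` have level
below `b` (0 if in no marked vector). At most `b ≤ t` generators occur in `rep S b`, with
multiplicity, so the base `t + 1` makes a single generator of level `b` outweigh them. -/
theorem weight_rep_lt {t : ℕ} (ht : BettiChain S t) {z : minimalGenerators S →₀ ℕ}
    (hz : Marked z) (hzt : leS S (phi S z) t) : weight t (rep S (phi S z)) < weight t z := by
  have hb := hz.mem_Betti
  have hpos := Nat.pos_of_ne_zero (Betti.pos hb)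
  calc weight t (rep S (phi S z))
      ≤ (rep S (phi S z)).sum fun g a => (a * g) * (t + 1) ^ (phi S z - 1) := by
        refine Finset.sum_le_sum fun g hg => Nat.mul_le_mul ?_ (Nat.pow_le_pow_right (by omega) ?_)
        · exact Nat.le_mul_of_pos_right _ (Nat.pos_of_ne_zero g.2.2.1)
        · unfold level
          split_ifs with h
          · obtain ⟨h1, h2, h3⟩ := h.choose_spec
            have hmeet : Meets h.choose (rep S (phi S z)) := ⟨g, h3, Finsupp.mem_support_iff.1 hg⟩
            rcases ht.total h1.mem_Betti h2 hb hzt with hle | hle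
            · refine Nat.le_sub_one_of_lt (lt_of_le_of_ne hle.le fun heq => ?_)
              exact h1.not_meets_rep ht h2 hb (heq ▸ leS.refl _) hmeet
            · exact absurd hmeet (h1.not_meets_rep ht h2 hb hle)
          · exact Nat.zero_le _
    _ = phi S z * (t + 1) ^ (phi S z - 1) := by
        rw [Finsupp.sum, ← Finset.sum_mul]
        congr 1
        exact phi_rep (phi_mem z)
    _ < (t + 1) * (t + 1) ^ (phi S z - 1) :=
        Nat.mul_lt_mul_of_pos_right (Nat.lt_succ_of_le hzt.le) (by positivity)
    _ = (t + 1) ^ phi S z := by rw [← pow_succ', Nat.sub_add_cancel hpos]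
    _ ≤ weight t z := by
        obtain ⟨g, hg⟩ := DFunLike.ne_iff.1 hz.ne_zero
        simp only [Finsupp.coe_zero, Pi.zero_apply] at hg
        rw [← level_eq ht hz hzt hg]
        exact (Nat.le_mul_of_pos_left _ (Nat.pos_of_ne_zero hg)).trans
          (Finset.single_le_sum (f := fun g => z g * (t + 1) ^ level t g)
            (fun _ _ => Nat.zero_le _) (Finsupp.mem_support_iff.2 hg))

theorem exists_normal {t : ℕ} (ht : BettiChain S t) (x : minimalGenerators S →₀ ℕ) :
    ∃ y, Normal t y ∧ phi S y = phi S x := by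
  induction hn : weight t x using Nat.strong_induction_on generalizing x with
  | _ n ih =>
    by_cases hx : Normal t x
    · exact ⟨x, hx, rfl⟩
    · simp only [Normal, not_forall, not_not] at hx
      obtain ⟨z, hz, hzt, hle⟩ := hx
      obtain ⟨w, rfl⟩ := exists_add_of_le hle
      have := weight_rep_lt ht hz hzt
      rw [weight_add] at hn
      obtain ⟨y, hy, hyx⟩ := ih _ (by omega) (rep S (phi S z) + w) (weight_add _ _)
      exact ⟨y, hy, by rw [hyx, phi_add, phi_add, phi_rep (phi_mem z)]⟩

/-- The `R`-class of a factorization of `s`. -/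
def rclass {s : ℕ} (x : minimalGenerators S →₀ ℕ) (hx : phi S x = s) : RClass S s :=
  (nabla S s).connectedComponentMk (Subtype.mk x hx : Factorization S s)

theorem rclass_eq_iff {s : ℕ} {x y : minimalGenerators S →₀ ℕ} (hx : phi S x = s)
    (hy : phi S y = s) : rclass x hx = rclass y hy ↔ Linked x y :=
  SimpleGraph.ConnectedComponent.eq.trans (reachable_iff_linked _ _)

theorem exists_rclass_eq {s : ℕ} (d : RClass S s) : ∃ x, ∃ hx : phi S x = s, rclass x hx = d := by
  induction d using SimpleGraph.ConnectedComponent.ind with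
  | _ v => exact ⟨v.1, v.2, rfl⟩

/-- Marked factorizations are isolated, so each `R`-class other than that of `rep S t` consists of
exactly one of them. -/
theorem card_RClass [Finite (minimalGenerators S)] {t : ℕ} (ht : BettiChain S t) (hs : t ∈ S) :
    Nat.card (RClass S t) = {z | Marked z ∧ phi S z = t}.ncard + 1 := by
  classical
  have : Finite (Factorization S t) := finite_factorizations t
  let _ := Fintype.ofFinite (RClass S t)
  let c : RClass S t := rclass (rep S t) (phi_rep hs)
  let f (z : {z : minimalGenerators S →₀ ℕ | Marked z ∧ phi S z = t}) : {d : RClass S t // d ≠ c} :=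
    ⟨rclass z.1 z.2.2, fun h => z.2.1 (z.2.2.symm ▸ (rclass_eq_iff _ _).1 h)⟩
  have hf : Function.Bijective f := by
    constructor
    · rintro ⟨z, hz, rfl⟩ ⟨z', hz', hzt'⟩ h
      exact Subtype.ext ((hz.isolated ht).eq_of_linked
        ((rclass_eq_iff _ _).1 (Subtype.ext_iff.1 h))).symm
    · rintro ⟨d, hd⟩
      obtain ⟨v, rfl, rfl⟩ := exists_rclass_eq d
      exact ⟨⟨v, fun h => hd ((rclass_eq_iff _ _).2 h), rfl⟩, rfl⟩
  rw [← Nat.card_coe_set_eq, Nat.card_eq_of_bijective f hf, Nat.card_eq_fintype_card,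
    Nat.card_eq_fintype_card, Fintype.card_subtype_compl]
  have := Fintype.card_pos_iff.2 ⟨c⟩
  simp only [Fintype.card_subtype_eq]
  omega

end Factorizations

/-! ### Counting factorizations -/

section Counting

variable {S : AddSubmonoid ℕ}

/-- The generating function of the factorizations that contain no element of `A`. -/
noncomputable def avoidSeries (A : Set (minimalGenerators S →₀ ℕ)) : ℤ⟦X⟧ :=
  PowerSeries.mk fun s => ({x | phi S x = s ∧ ∀ z ∈ A, ¬ z ≤ x}.ncard : ℤ)

variable [Finite (minimalGenerators S)]

/-- The vectors avoiding `A` that contain `z` are exactly the `z + w` with `w` avoiding `A`: an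
element of `A` disjoint from `z` and contained in `z + w` is already contained in `w`. -/
theorem avoidSeries_insert (A : Set (minimalGenerators S →₀ ℕ)) (z : minimalGenerators S →₀ ℕ)
    (hz : ∀ y ∈ A, ¬ Meets y z) :
    avoidSeries (insert z A) = avoidSeries A * (1 - X ^ phi S z) := by
  ext s
  rw [mul_sub, mul_one, map_sub, coeff_mul_X_pow']
  simp only [avoidSeries, coeff_mk]
  have hfin : ∀ (B : Set (minimalGenerators S →₀ ℕ)) s,
      {x | phi S x = s ∧ ∀ y ∈ B, ¬ y ≤ x}.Finite := fun B s =>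
    (finite_factorizations s).subset fun x hx => hx.1
  split_ifs with hs
  · have hunion : {x | phi S x = s ∧ ∀ y ∈ A, ¬ y ≤ x} =
        {x | phi S x = s ∧ ∀ y ∈ insert z A, ¬ y ≤ x} ∪
          (z + ·) '' {x | phi S x = s - phi S z ∧ ∀ y ∈ A, ¬ y ≤ x} := by
      ext x
      simp only [Set.mem_union, Set.mem_ofPred_eq, Set.mem_image, Set.forall_mem_insert]
      constructor
      · rintro ⟨hx, hA⟩
        by_cases hzx : z ≤ x
        · obtain ⟨w, rfl⟩ := exists_add_of_le hzx
          rw [phi_add] at hx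
          exact Or.inr ⟨w, ⟨by omega, fun y hy hle => hA y hy (hle.trans le_add_self)⟩, rfl⟩
        · exact Or.inl ⟨hx, hzx, hA⟩
      · rintro (⟨hx, -, hA⟩ | ⟨w, ⟨hw, hA⟩, rfl⟩)
        · exact ⟨hx, hA⟩
        · rw [phi_add]
          exact ⟨by omega, fun y hy hle => hA y hy (le_of_le_add_of_not_meets (hz y hy) hle)⟩
    rw [hunion, Set.ncard_union_eq ?_ (hfin _ _) ((hfin _ _).image _),
      Set.ncard_image_of_injective _ (add_right_injective z)]
    · push_cast; ring
    · rw [Set.disjoint_left]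
      rintro _ ⟨-, hx⟩ ⟨w, -, rfl⟩
      exact hx z (Set.mem_insert _ _) le_self_add
  · rw [sub_zero]
    congr 2
    ext x
    simp only [Set.mem_ofPred_eq, Set.forall_mem_insert]
    refine ⟨fun h => ⟨h.1, h.2.2⟩, fun h => ⟨h.1, fun hle => hs ?_, h.2⟩⟩
    obtain ⟨w, rfl⟩ := exists_add_of_le hle
    rw [← h.1, phi_add]
    exact Nat.le_add_right _ _

theorem avoidSeries_eq_prod (A : Finset (minimalGenerators S →₀ ℕ))
    (hA : ∀ y ∈ A, ∀ z ∈ A, y ≠ z → ¬ Meets y z) :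
    avoidSeries (A : Set (minimalGenerators S →₀ ℕ)) =
      avoidSeries (∅ : Set (minimalGenerators S →₀ ℕ)) * ∏ z ∈ A, (1 - X ^ phi S z) := by
  classical
  induction A using Finset.induction_on with
  | empty => simp
  | insert z A hz ih =>
    rw [Finset.coe_insert, avoidSeries_insert, ih, Finset.prod_insert hz]
    · ring
    · exact fun x hx y hy => hA x (Finset.mem_insert_of_mem hx) y (Finset.mem_insert_of_mem hy)
    · exact fun y hy => hA y (Finset.mem_insert_of_mem hy) z (Finset.mem_insert_self _ _)
        (fun h => hz (h ▸ hy))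

/-- Apply the product formula to the set of all single generators: only the zero vector avoids them
all. -/
theorem avoidSeries_empty_mul [Fintype (minimalGenerators S)] :
    avoidSeries (∅ : Set (minimalGenerators S →₀ ℕ)) *
      ∏ g : minimalGenerators S, (1 - X ^ (g : ℕ)) = 1 := by
  classical
  have hinj : Function.Injective fun g : minimalGenerators S => Finsupp.single g 1 :=
    Finsupp.single_left_injective one_ne_zero
  have h := avoidSeries_eq_prod (S := S)
    (Finset.univ.image fun g : minimalGenerators S => Finsupp.single g 1) (by
      simp only [Finset.mem_image, Finset.mem_univ, true_and]
      rintro _ ⟨g, rfl⟩ _ ⟨g', rfl⟩ hne ⟨n, h1, h2⟩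
      rw [Finsupp.single_apply_ne_zero] at h1 h2
      exact hne (by rw [← h1.1, ← h2.1]))
  rw [Finset.prod_image (fun _ _ _ _ h => hinj h)] at h
  simp only [phi_single, one_mul] at h
  rw [← h]
  ext s
  rw [avoidSeries, coeff_mk, coeff_one]
  have : {x : minimalGenerators S →₀ ℕ | phi S x = s ∧
      ∀ z ∈ ((Finset.univ.image fun g : minimalGenerators S => Finsupp.single g 1 :
        Finset (minimalGenerators S →₀ ℕ)) : Set (minimalGenerators S →₀ ℕ)), ¬ z ≤ x} =
      if s = 0 then {0} else ∅ := by
    have hx : ∀ x : minimalGenerators S →₀ ℕ, (∀ g, ¬ Finsupp.single g 1 ≤ x) → x = 0 := by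
      intro x hx
      ext g
      by_contra h0
      exact hx g (Finsupp.single_le_iff.2 (Nat.pos_of_ne_zero h0))
    ext x
    simp only [Finset.coe_image, Finset.coe_univ, Set.image_univ, Set.forall_mem_range,
      Set.mem_ofPred_eq]
    split_ifs with hs
    · subst hs
      rw [phi_eq_zero, Set.mem_singleton_iff]
      refine ⟨fun h => h.1, fun h => ⟨h, fun g hg => ?_⟩⟩
      subst h
      simpa using hg g
    · simp only [Set.mem_empty_iff_false, iff_false]
      rintro ⟨rfl, h⟩
      exact hs (phi_eq_zero.2 (hx x h))
  rw [this]
  split_ifs <;> simp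

theorem coeff_avoidSeries_marked {t u : ℕ} (ht : BettiChain S t) (hu : leS S u t) :
    coeff u (avoidSeries {z : minimalGenerators S →₀ ℕ | Marked z ∧ leS S (phi S z) t}) =
      coeff u (hilbertSeries S) := by
  rw [avoidSeries, hilbertSeries, coeff_mk, coeff_mk]
  split_ifs with huS
  · obtain ⟨x, rfl⟩ := exists_phi_eq huS
    obtain ⟨y, hy, hyx⟩ := exists_normal ht x
    have : {v | phi S v = phi S x ∧ ∀ z ∈ {z : minimalGenerators S →₀ ℕ |
        Marked z ∧ leS S (phi S z) t}, ¬ z ≤ v} = {y} := by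
      ext v
      simp only [Set.mem_ofPred_eq, Set.mem_singleton_iff]
      constructor
      · rintro ⟨hv, h⟩
        exact Normal.eq ht (fun z hz hzt => h z ⟨hz, hzt⟩) hy (hv.trans hyx.symm) (hv ▸ hu)
      · rintro rfl
        exact ⟨hyx, fun z hz => hy z hz.1 hz.2⟩
    rw [this, Set.ncard_singleton, Nat.cast_one]
  · rw [Nat.cast_eq_zero, Set.ncard_eq_zero ((finite_factorizations u).subset fun x hx => hx.1)]
    refine Set.eq_empty_of_forall_notMem fun x hx => huS ?_
    rw [← hx.1]
    exact phi_mem x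

end Counting

/-! ### Products of powers of `1 - x^j` -/

/-- `∏_{1 ≤ j ≤ N} (1 - x^j)^{f_j}` as a unit. -/
noncomputable def unitProd (f : ℕ → ℤ) (N : ℕ) : ℤ⟦X⟧ˣ :=
  ∏ i ∈ Finset.range N, oneSubXPow i.succPNat ^ f (i + 1)

theorem val_unitProd (f : ℕ → ℤ) (N : ℕ) : (unitProd f N : ℤ⟦X⟧) = partialProd f N :=
  Units.coe_prod _ _

theorem unitProd_sub (f h : ℕ → ℤ) (N : ℕ) :
    unitProd (fun j => f j - h j) N = unitProd f N * (unitProd h N)⁻¹ := by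
  simp only [unitProd, zpow_sub, Finset.prod_mul_distrib, Finset.prod_inv_distrib]

theorem val_unitProd_card {ι : Type*} (A : Finset ι) (d : ι → ℕ) (N : ℕ)
    (hd : ∀ z ∈ A, 1 ≤ d z ∧ d z ≤ N) :
    (unitProd (fun j => ((A.filter fun z => d z = j).card : ℤ)) N : ℤ⟦X⟧) =
      ∏ z ∈ A, (1 - X ^ d z) := by
  rw [unitProd, Units.coe_prod, ← Finset.prod_fiberwise_of_maps_to (t := Finset.range N)
    (g := fun z => d z - 1) (fun z hz => by have := hd z hz; simp; omega)]
  refine Finset.prod_congr rfl fun i _ => ?_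
  have : (A.filter fun z => d z - 1 = i) = A.filter fun z => d z = i + 1 :=
    Finset.filter_congr fun z hz => by have := hd z hz; omega
  rw [this, zpow_natCast, Units.val_pow_eq_pow_val, ← Finset.prod_const]
  refine Finset.prod_congr rfl fun z hz => ?_
  rw [(Finset.mem_filter.1 hz).2]
  rfl

/-- Power series supported on `S`. -/
def supportedOn (S : AddSubmonoid ℕ) : Subring ℤ⟦X⟧ where
  carrier := {F | ∀ n ∉ S, coeff n F = 0}
  mul_mem' := by
    intro F G hF hG n hn
    rw [coeff_mul]
    refine Finset.sum_eq_zero fun p hp => ?_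
    have hp := Finset.HasAntidiagonal.mem_antidiagonal.1 hp
    by_cases h1 : p.1 ∈ S
    · by_cases h2 : p.2 ∈ S
      · exact absurd (hp ▸ add_mem h1 h2) hn
      · rw [hG _ h2, mul_zero]
    · rw [hF _ h1, zero_mul]
  one_mem' := by
    intro n hn
    rw [coeff_one, if_neg]
    rintro rfl
    exact hn (zero_mem S)
  add_mem' := by
    intro F G hF hG n hn
    rw [map_add, hF n hn, hG n hn, add_zero]
  zero_mem' := by intro n _; simp
  neg_mem' := by
    intro F hF n hn
    rw [map_neg, hF n hn, neg_zero]

/-- Two power series agree below `t` if their coefficients agree at all `u ≤_S t`. -/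
def AgreeBelow (S : AddSubmonoid ℕ) (t : ℕ) (F G : ℤ⟦X⟧) : Prop :=
  ∀ u, leS S u t → coeff u F = coeff u G

/-- In the coefficient at `u`, a term with second index in `S` has first index `≤_S u`, hence `≤_S
t`; the other terms vanish. -/
theorem AgreeBelow.mul_right {S : AddSubmonoid ℕ} {t : ℕ} {F G K : ℤ⟦X⟧}
    (h : AgreeBelow S t F G) (hK : K ∈ supportedOn S) : AgreeBelow S t (F * K) (G * K) := by
  intro u hu
  rw [coeff_mul, coeff_mul]
  refine Finset.sum_congr rfl fun p hp => ?_
  have hp := Finset.HasAntidiagonal.mem_antidiagonal.1 hp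
  by_cases h2 : p.2 ∈ S
  · rw [h p.1 (leS.trans ⟨p.2, h2, hp⟩ hu)]
  · rw [hK _ h2, mul_zero, mul_zero]

/-- The units that are, together with their inverses, supported on `S`. -/
def unitsOn (S : AddSubmonoid ℕ) : Subgroup ℤ⟦X⟧ˣ where
  carrier := {u | (u : ℤ⟦X⟧) ∈ supportedOn S ∧ ((u⁻¹ : ℤ⟦X⟧ˣ) : ℤ⟦X⟧) ∈ supportedOn S}
  mul_mem' := by
    intro u v hu hv
    refine ⟨mul_mem hu.1 hv.1, ?_⟩
    rw [mul_inv]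
    exact mul_mem hu.2 hv.2
  one_mem' := by simp [one_mem]
  inv_mem' := fun h => ⟨h.2, by rw [inv_inv]; exact h.1⟩

/-- The units supported on `S` that agree with `1` below `t`. -/
def oneUnitsOn (S : AddSubmonoid ℕ) (t : ℕ) : Subgroup ℤ⟦X⟧ˣ where
  carrier := {u | u ∈ unitsOn S ∧ AgreeBelow S t u 1}
  mul_mem' := by
    intro u v hu hv
    refine ⟨mul_mem hu.1 hv.1, fun n hn => ?_⟩
    rw [Units.val_mul, hu.2.mul_right hv.1.1 n hn, one_mul, hv.2 n hn]
  one_mem' := ⟨one_mem _, fun _ _ => rfl⟩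
  inv_mem' := by
    intro u hu
    refine ⟨inv_mem hu.1, fun n hn => ?_⟩
    have := hu.2.mul_right hu.1.2 n hn
    rw [Units.mul_inv, one_mul] at this
    exact this.symm

theorem oneSubXPow_mem_unitsOn {S : AddSubmonoid ℕ} {j : ℕ+} (hj : (j : ℕ) ∈ S) :
    oneSubXPow j ∈ unitsOn S := by
  constructor
  · refine sub_mem (one_mem _) fun n hn => ?_
    rw [coeff_X_pow, if_neg]
    rintro rfl
    exact hn hj
  · intro n hn
    change coeff n (PowerSeries.mk fun n => if (j : ℕ) ∣ n then (1 : ℤ) else 0) = 0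
    rw [coeff_mk, if_neg]
    rintro ⟨k, rfl⟩
    exact hn (by simpa [mul_comm] using nsmul_mem hj k)

theorem oneSubXPow_mem_oneUnitsOn {S : AddSubmonoid ℕ} {t : ℕ} {j : ℕ+} (hj : (j : ℕ) ∈ S)
    (hjt : ¬ leS S j t) : oneSubXPow j ∈ oneUnitsOn S t := by
  refine ⟨oneSubXPow_mem_unitsOn hj, fun n hn => ?_⟩
  change coeff n ((1 : ℤ⟦X⟧) - X ^ (j : ℕ)) = _
  rw [map_sub, coeff_X_pow, if_neg, sub_zero]
  rintro rfl
  exact hjt hn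

theorem unitProd_mem_unitsOn {S : AddSubmonoid ℕ} {f : ℕ → ℤ} {N : ℕ}
    (hf : ∀ j, 1 ≤ j → j ≤ N → j ∉ S → f j = 0) : unitProd f N ∈ unitsOn S := by
  refine prod_mem fun i hi => ?_
  rw [Finset.mem_range] at hi
  by_cases h : i + 1 ∈ S
  · exact zpow_mem (oneSubXPow_mem_unitsOn h) _
  · rw [hf _ (by omega) (by omega) h, zpow_zero]
    exact one_mem _

/-- The exponent at `t` of a product is determined by the coefficients at `u ≤_S t` and by the
exponents at `u <_S t`. -/
theorem exponent_eq_of_agreeBelow {S : AddSubmonoid ℕ} {f h : ℕ → ℤ} {N t : ℕ} (h1 : 1 ≤ t)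
    (htN : t ≤ N) (hf : ∀ j, 1 ≤ j → j ≤ N → j ∉ S → f j = 0)
    (hh : ∀ j, 1 ≤ j → j ≤ N → j ∉ S → h j = 0)
    (hfh : ∀ j, 1 ≤ j → j < t → leS S j t → f j = h j)
    (hagree : AgreeBelow S t (unitProd f N : ℤ⟦X⟧) (unitProd h N : ℤ⟦X⟧)) : f t = h t := by
  obtain ⟨k, rfl⟩ : ∃ k, t = k + 1 := ⟨t - 1, by omega⟩
  have hd : AgreeBelow S (k + 1) (unitProd (fun j => f j - h j) N : ℤ⟦X⟧) 1 := by
    have := hagree.mul_right (unitProd_mem_unitsOn hh).2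
    rwa [← Units.val_mul, ← Units.val_mul, ← unitProd_sub, mul_inv_cancel] at this
  -- Every factor other than the one at `t = k + 1` has exponent 0 or an index in `S` not below `t`,
  -- so `V` looks like 1 below `t`. What remains is a power of `1 - x^t`, whose coefficient at `t`
  -- is minus its exponent.
  set V := ∏ i ∈ (Finset.range N).erase k, oneSubXPow i.succPNat ^ (f (i + 1) - h (i + 1))
  have hV : V ∈ oneUnitsOn S (k + 1) := by
    refine prod_mem fun i hi => ?_
    rw [Finset.mem_erase, Finset.mem_range] at hi
    by_cases hi0 : f (i + 1) - h (i + 1) = 0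
    · rw [hi0, zpow_zero]
      exact one_mem _
    · refine zpow_mem (oneSubXPow_mem_oneUnitsOn ?_ fun hle => hi0 ?_) _
      · by_contra hS
        rw [Nat.succPNat_coe, Nat.succ_eq_add_one] at hS
        exact hi0 (by rw [hf _ (by omega) (by omega) hS, hh _ (by omega) (by omega) hS, sub_zero])
      · have : i + 1 ≤ k + 1 := hle.le
        exact sub_eq_zero.2 (hfh _ (by omega) (by omega) hle)
  have hprod : oneSubXPow k.succPNat ^ (f (k + 1) - h (k + 1)) =
      unitProd (fun j => f j - h j) N * V⁻¹ := by
    rw [_root_.eq_mul_inv_iff_mul_eq]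
    exact Finset.mul_prod_erase (Finset.range N)
      (fun i => oneSubXPow i.succPNat ^ (f (i + 1) - h (i + 1))) (by simp; omega)
  have hk := leS.refl (S := S) (k + 1)
  have hc := hd.mul_right hV.1.2 _ hk
  rw [← Units.val_mul, ← hprod, one_mul, (inv_mem hV).2 _ hk] at hc
  have := coeff_mul_zpow 1 k.succPNat (f (k + 1) - h (k + 1)) (k + 1) le_rfl
  rw [one_mul, hc] at this
  simp at this
  omega

/-! ### The exponents of the Hilbert series -/

/-- `H_S(x) = ∏_{j ≥ 1} (1 - x^j)^{f_j}`. -/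
def IsHilbertExponent (S : AddSubmonoid ℕ) (f : ℕ → ℤ) : Prop :=
  ∀ n N, n ≤ N → coeff n (unitProd f N : ℤ⟦X⟧) = coeff n (hilbertSeries S)

theorem IsCyclotomicExponentSequence.isHilbertExponent {S : AddSubmonoid ℕ} {e : ℕ → ℤ}
    (he : IsCyclotomicExponentSequence S e) :
    IsHilbertExponent S fun j => e j - if j = 1 then 1 else 0 := by
  rw [IsCyclotomicExponentSequence, hasProd_iff_coeff] at he
  intro n N hnN
  -- The upper limit is `N + 1` so that the factor `j = 1` is present even for `N = 0`; stability of
  -- coefficients then returns to `N`.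
  have hone : ∀ N, (unitProd (fun j => if j = 1 then 1 else 0) (N + 1) : ℤ⟦X⟧) = 1 - X := by
    intro N
    rw [unitProd, Finset.prod_range_succ', Finset.prod_eq_one]
    · simp [oneSubXPow]
    · intro i _
      simp
  have hdvd : (X : ℤ⟦X⟧) ^ (N + 2) ∣ (1 - X) *
      ((unitProd (fun j => e j - if j = 1 then 1 else 0) (N + 1) : ℤ⟦X⟧) - hilbertSeries S) := by
    rw [X_pow_dvd_iff]
    intro m hm
    have h1 : (1 - X) * (unitProd (fun j => e j - if j = 1 then 1 else 0) (N + 1) : ℤ⟦X⟧) =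
        partialProd e (N + 1) := by
      rw [← hone N, ← val_unitProd, unitProd_sub, ← Units.val_mul, mul_comm, inv_mul_cancel_right]
    rw [mul_sub, h1, map_sub, sub_eq_zero, coeff_partialProd_of_le _ _ _ (by omega), he]
    rfl
  rw [← hone N, Units.dvd_mul_left, X_pow_dvd_iff] at hdvd
  have h := hdvd n (by omega)
  rw [map_sub, sub_eq_zero, val_unitProd, coeff_partialProd_of_le _ _ _ (by omega)] at h
  rw [val_unitProd, coeff_partialProd_of_le _ _ _ hnN, h]

/-- By induction the partial product up to `j - 1` is supported on `S`. Neither it nor `H_S` has a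
term `x^j`, and the difference of the two coefficients is `f j` up to sign. -/
theorem IsHilbertExponent.eq_zero {S : AddSubmonoid ℕ} {f : ℕ → ℤ} (hf : IsHilbertExponent S f)
    {j : ℕ} (hj : j ∉ S) : f j = 0 := by
  induction j using Nat.strong_induction_on with
  | _ j ih =>
    obtain ⟨k, rfl⟩ : ∃ k, j = k + 1 := by
      refine ⟨j - 1, ?_⟩
      rcases Nat.eq_zero_or_pos j with rfl | h
      · exact absurd (zero_mem S) hj
      · omega
    have h1 := (unitProd_mem_unitsOn (S := S) (f := f) (N := k)
      fun i _ hi hiS => ih i (by omega) hiS).1 _ hj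
    have h2 := hf (k + 1) (k + 1) le_rfl
    rw [val_unitProd, coeff_partialProd_succ _ _ _ le_rfl, ← val_unitProd, h1, hilbertSeries,
      coeff_mk, if_neg hj] at h2
    simpa using h2

open Classical in
/-- The exponent predicted by the minimal generators and the marked factorizations. -/
noncomputable def predictedExponent (S : AddSubmonoid ℕ) (j : ℕ) : ℤ :=
  ({z : minimalGenerators S →₀ ℕ | Marked z ∧ phi S z = j}.ncard : ℤ) -
    if j ∈ minimalGenerators S then 1 else 0

theorem IsHilbertExponent.eq_predictedExponent {S : AddSubmonoid ℕ}
    (hS : IsNumericalSemigroup S) {f : ℕ → ℤ} (hf : IsHilbertExponent S f) {t : ℕ} (ht1 : 1 ≤ t)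
    (ht : BettiChain S t) : f t = predictedExponent S t := by
  classical
  induction t using Nat.strong_induction_on with
  | _ t ih =>
    have hfin := finite_minimalGenerators hS
    have : Finite (minimalGenerators S) := hfin
    let _ : Fintype (minimalGenerators S) := Fintype.ofFinite _
    -- Generators may exceed `t`, so the products run to `max t B` to include every factor of the
    -- denominator.
    obtain ⟨B, hB⟩ := hfin.bddAbove
    have hRfin : {z : minimalGenerators S →₀ ℕ | Marked z ∧ leS S (phi S z) t}.Finite := by
      refine ((Set.finite_Iic t).biUnion fun s _ => finite_factorizations (S := S) s).subset ?_
      exact fun z hz => Set.mem_biUnion (Set.mem_Iic.2 hz.2.le) rfl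
    set R := hRfin.toFinset with hRdef
    have hR : ∀ z, z ∈ R ↔ Marked z ∧ leS S (phi S z) t := fun z => hRfin.mem_toFinset
    let c1 : ℕ → ℤ := fun j => ((R.filter fun z => phi S z = j).card : ℤ)
    let c2 : ℕ → ℤ := fun j =>
      ((Finset.univ.filter fun g : minimalGenerators S => (g : ℕ) = j).card : ℤ)
    have hc2 : ∀ j, c2 j = if j ∈ minimalGenerators S then 1 else 0 := by
      intro j
      simp only [c2]
      split_ifs with hj
      · rw [Nat.cast_eq_one, Finset.card_eq_one]
        refine ⟨⟨j, hj⟩, ?_⟩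
        ext g
        simp [Subtype.ext_iff]
      · rw [Nat.cast_eq_zero, Finset.card_eq_zero, Finset.filter_eq_empty_iff]
        rintro g - rfl
        exact hj g.2
    -- `c1` counts only marked vectors below `t`, so it gives the full count only at indices `j ≤_S
    -- t`, which is all the comparison needs.
    have hc1 : ∀ j, leS S j t →
        c1 j = ({z : minimalGenerators S →₀ ℕ | Marked z ∧ phi S z = j}.ncard : ℤ) := by
      intro j hj
      simp only [c1]
      rw [← Set.ncard_coe_finset]
      congr 2
      ext z
      simp only [Finset.coe_filter, hR, Set.mem_ofPred_eq]
      exact ⟨fun h => ⟨h.1.1, h.2⟩, fun h => ⟨⟨h.1, h.2 ▸ hj⟩, h.2⟩⟩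
    have hpred : ∀ j, leS S j t → c1 j - c2 j = predictedExponent S j := fun j hj => by
      rw [predictedExponent, hc1 j hj, hc2]
    have hD : avoidSeries (∅ : Set (minimalGenerators S →₀ ℕ)) =
        ((unitProd c2 (max t B))⁻¹ : ℤ⟦X⟧ˣ) := by
      rw [← Units.mul_eq_one_iff_eq_inv, val_unitProd_card]
      · exact avoidSeries_empty_mul
      · exact fun g _ => ⟨Nat.pos_of_ne_zero g.2.2.1, (hB g.2).trans (le_max_right _ _)⟩
    have hprod : (unitProd (fun j => c1 j - c2 j) (max t B) : ℤ⟦X⟧) =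
        avoidSeries {z : minimalGenerators S →₀ ℕ | Marked z ∧ leS S (phi S z) t} := by
      rw [unitProd_sub, mul_comm, Units.val_mul, ← hD, val_unitProd_card,
        ← avoidSeries_eq_prod, hRdef, hRfin.coe_toFinset]
      · intro y hy z hz
        rw [hR] at hy hz
        exact hy.1.not_meets ht hy.2 hz.1 hz.2
      · intro z hz
        rw [hR] at hz
        exact ⟨Nat.pos_of_ne_zero (Betti.pos hz.1.mem_Betti), hz.2.le.trans (le_max_left _ _)⟩
    rw [← hpred t (leS.refl t)]
    refine exponent_eq_of_agreeBelow (S := S) (h := fun j => c1 j - c2 j) ht1 (le_max_left t B)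
      (fun j _ _ hj => hf.eq_zero hj) (fun j _ _ hj => ?_) (fun j hj1 hjt hle => ?_) fun u hu => ?_
    · have h1 : c1 j = 0 := by
        simp only [c1]
        rw [Nat.cast_eq_zero, Finset.card_eq_zero, Finset.filter_eq_empty_iff]
        rintro z - rfl
        exact hj (phi_mem z)
      simp only [h1, hc2, if_neg fun h : j ∈ minimalGenerators S => hj h.1, sub_zero]
    · rw [hpred j hle]
      exact ih j hjt hj1 (ht.mono hle)
    · rw [hprod, coeff_avoidSeries_marked ht hu, hf _ _ (hu.le.trans (le_max_left _ _))]

/-! ### Betti elements and exponents -/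

/-- A minimal generator has only one factorization. -/
theorem notMem_minimalGenerators_of_mem_Betti {S : AddSubmonoid ℕ} {b : ℕ} (hb : b ∈ Betti S) :
    b ∉ minimalGenerators S := by
  intro hg
  obtain ⟨x, y, hx, hy, h⟩ := mem_Betti_iff.1 hb
  have key : ∀ x : minimalGenerators S →₀ ℕ, phi S x = b → x = Finsupp.single ⟨b, hg⟩ 1 := by
    intro x hx
    have hx0 : x ≠ 0 := by
      rintro rfl
      exact hg.2.1 (hx.symm.trans phi_zero)
    obtain ⟨g, hxg⟩ := DFunLike.ne_iff.1 hx0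
    obtain ⟨y, rfl⟩ := exists_eq_single_add hxg
    rw [phi_add, phi_single, one_mul] at hx
    rcases hg.2.2 g g.2.1 _ (phi_mem y) hx with h | h
    · exact absurd h g.2.2.1
    · rw [h, add_zero] at hx
      rw [phi_eq_zero.1 h, add_zero]
      congr 1
      exact Subtype.ext hx
  rw [key x hx, key y hy] at h
  exact h Relation.ReflTransGen.refl

theorem one_mem_minimalGenerators {S : AddSubmonoid ℕ} (h : 1 ∈ S) : 1 ∈ minimalGenerators S :=
  ⟨h, one_ne_zero, fun a _ b _ hab => by omega⟩

theorem two_le_of_mem_Betti {S : AddSubmonoid ℕ} {b : ℕ} (hb : b ∈ Betti S) : 2 ≤ b := by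
  have h0 := Betti.pos hb
  have h1 : b ≠ 1 := by
    rintro rfl
    exact notMem_minimalGenerators_of_mem_Betti hb (one_mem_minimalGenerators hb.1)
  omega

theorem mem_Betti_iff_exists_marked {S : AddSubmonoid ℕ} {b : ℕ} :
    b ∈ Betti S ↔ ∃ z : minimalGenerators S →₀ ℕ, Marked z ∧ phi S z = b := by
  constructor
  · intro hb
    obtain ⟨x, y, rfl, hy, h⟩ := mem_Betti_iff.1 hb
    by_cases hx : Marked x
    · exact ⟨x, hx, rfl⟩
    · refine ⟨y, fun hy' => h ?_, hy⟩
      rw [Marked, not_not] at hx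
      exact hx.trans (hy ▸ hy').symm
  · rintro ⟨z, hz, rfl⟩
    exact hz.mem_Betti

theorem exponent_eq_ncard {S : AddSubmonoid ℕ} (hS : IsNumericalSemigroup S) {e : ℕ → ℤ}
    (he : IsCyclotomicExponentSequence S e) {t : ℕ} (ht2 : 2 ≤ t) (hg : t ∉ minimalGenerators S)
    (ht : BettiChain S t) :
    e t = ({z : minimalGenerators S →₀ ℕ | Marked z ∧ phi S z = t}.ncard : ℤ) := by
  have h := he.isHilbertExponent.eq_predictedExponent hS (by omega) ht
  simpa [predictedExponent, hg, show t ≠ 1 by omega] using h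

theorem mem_Betti_iff_mem_exponentSet {S : AddSubmonoid ℕ} (hS : IsNumericalSemigroup S)
    {e : ℕ → ℤ} (he : IsCyclotomicExponentSequence S e) {t : ℕ} (ht : BettiChain S t) :
    t ∈ Betti S ↔ t ∈ exponentSet S e := by
  have : Finite (minimalGenerators S) := finite_minimalGenerators hS
  by_cases h2 : 2 ≤ t
  · by_cases hg : t ∈ minimalGenerators S
    · exact ⟨fun h => absurd hg (notMem_minimalGenerators_of_mem_Betti h), fun h => absurd hg h.2.2⟩
    · have hcard := exponent_eq_ncard hS he h2 hg ht
      have hfin : {z : minimalGenerators S →₀ ℕ | Marked z ∧ phi S z = t}.Finite :=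
        (finite_factorizations t).subset fun z hz => hz.2
      have : t ∈ exponentSet S e ↔ e t ≠ 0 := ⟨fun h => h.2.1, fun h => ⟨h2, h, hg⟩⟩
      rw [this, hcard, Nat.cast_ne_zero, ← Nat.pos_iff_ne_zero, Set.ncard_pos hfin,
        mem_Betti_iff_exists_marked]
      rfl
  · exact ⟨fun h => absurd (two_le_of_mem_Betti h) h2, fun h => absurd h.1 h2⟩

/-- By strong induction the Betti elements strictly below `t` lie in `𝓔(S)`, so they are comparable
because `b ∈ U(𝓔(S))`. Only `t` itself may be a further Betti element, and it lies above all of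
them. -/
theorem bettiChain_of_mem_U {S : AddSubmonoid ℕ} (hS : IsNumericalSemigroup S)
    {e : ℕ → ℤ} (he : IsCyclotomicExponentSequence S e) {b : ℕ}
    (hb : b ∈ U (leS S) (exponentSet S e)) {t : ℕ} (htb : leS S t b) : BettiChain S t := by
  induction t using Nat.strong_induction_on with
  | _ t ih =>
    have hmem : ∀ c ∈ Betti S, leS S c t → c ≠ t → c ∈ {y | y ∈ exponentSet S e ∧ leS S y b} :=
      fun c hc hct hne => And.intro ((mem_Betti_iff_mem_exponentSet hS he
        (ih c (lt_of_le_of_ne hct.le hne) (hct.trans htb))).1 hc) (hct.trans htb)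
    rintro c ⟨hc, hct⟩ d ⟨hd, hdt⟩ hcd
    by_cases h1 : c = t
    · exact Or.inr (h1 ▸ hdt)
    by_cases h2 : d = t
    · exact Or.inl (h2 ▸ hct)
    exact hb.2 (hmem c hc hct h1) (hmem d hd hdt h2) hcd

end NumSgp

/-! ### The main theorem. -/

theorem theorem2 (S : AddSubmonoid ℕ) (hS : NumSgp.IsNumericalSemigroup S)
    (e : ℕ → ℤ) (he : NumSgp.IsCyclotomicExponentSequence S e) :
    NumSgp.U (NumSgp.leS S) (NumSgp.Betti S) =
        NumSgp.U (NumSgp.leS S) (NumSgp.exponentSet S e) ∧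
      ∀ b ∈ NumSgp.U (NumSgp.leS S) (NumSgp.Betti S),
        e b = (Nat.card (NumSgp.RClass S b) : ℤ) - 1 := by
  have hset : ∀ b, NumSgp.BettiChain S b →
      {y | y ∈ NumSgp.Betti S ∧ NumSgp.leS S y b} =
        {y | y ∈ NumSgp.exponentSet S e ∧ NumSgp.leS S y b} := fun b hb =>
    Set.ext fun y => and_congr_left fun hy =>
      NumSgp.mem_Betti_iff_mem_exponentSet hS he (hb.mono hy)
  refine ⟨Set.ext fun b => ⟨fun hb => ?_, fun hb => ?_⟩, fun b hb => ?_⟩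
  · have hc : NumSgp.BettiChain S b := hb.2
    exact And.intro ((NumSgp.mem_Betti_iff_mem_exponentSet hS he hc).1 hb.1) (hset b hc ▸ hb.2)
  · have hc := NumSgp.bettiChain_of_mem_U hS he hb (NumSgp.leS.refl b)
    exact And.intro ((NumSgp.mem_Betti_iff_mem_exponentSet hS he hc).2 hb.1) hc
  · have hc : NumSgp.BettiChain S b := hb.2
    have : Finite (NumSgp.minimalGenerators S) := NumSgp.finite_minimalGenerators hS
    rw [NumSgp.exponent_eq_ncard hS he (NumSgp.two_le_of_mem_Betti hb.1)
      (NumSgp.notMem_minimalGenerators_of_mem_Betti hb.1) hc, NumSgp.card_RClass hc hb.1.1]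
    push_cast
    ring
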